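/- Let $X$ be a complex Banach space. A bounded linear operator $S:X\to X$ is called strictly singular if for every infinite dimensional linear subspace $M$ of $X$ the restriction of $S$ to $M$ is not a homeomorphism onto its image $S(M)$. A bounded linear operator $T:X\to X$ satisfies the Strong Distributional Chaos Criterion (SDCC) if there is a constant $r>1$ such that for every $m\in\mathbb{N}$ there exists $x_m\in X\setminus\{0\}$ with (i) $\lim_{k\to\infty}\|T^k x_m\|=0$, and (ii) $\|T^i x_m\|\ge r^i\|x_m\|$ for $i=1,2,\dots,m$. **Corollary 3.6.** If $S:X\to X$ is a strictly singular bounded linear operator and $\lambda\in\mathbb{C}$, then $\lambda I+S$ does not satisfy the SDCC. -/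

import Mathlib

open Filter Topology

/-- A bounded operator `S : X → X` is strictly singular if for every infinite dimensional
linear subspace `M` of `X` the restriction of `S` to `M` is not a homeomorphism onto its image. -/
def IsStrictlySingular {X : Type*} [NormedAddCommGroup X] [NormedSpace ℂ X]
    (S : X →L[ℂ] X) : Prop :=
  ∀ M : Submodule ℂ X, ¬ FiniteDimensional ℂ M →
    ¬ Topology.IsEmbedding (fun x : M => S x)

/-- `r` is an SDCC-constant for the operator `T`. -/
def IsSDCCConstant {X : Type*} [NormedAddCommGroup X] [NormedSpace ℂ X]
    (T : X →L[ℂ] X) (r : ℝ) : Prop :=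
  1 < r ∧ ∀ m : ℕ, ∃ x : X, x ≠ 0 ∧
    Tendsto (fun k : ℕ => ‖(T ^ k) x‖) atTop (𝓝 0) ∧
    ∀ i : ℕ, 1 ≤ i → i ≤ m → r ^ i * ‖x‖ ≤ ‖(T ^ i) x‖

/-- The Strong Distributional Chaos Criterion. -/
def SatisfiesSDCC {X : Type*} [NormedAddCommGroup X] [NormedSpace ℂ X]
    (T : X →L[ℂ] X) : Prop :=
  ∃ r : ℝ, IsSDCCConstant T r

/-! ### Lower bounds for nonzero shifts of a strictly singular operator. -/

section BoundedBelow

variable {X : Type*} [NormedAddCommGroup X] [NormedSpace ℂ X]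

/-! Put `T = λI + S`. Suppose `z - T` is bounded below for every `z` on a circle `|z| = ρ` with `1 <
ρ < r`. For a bounded orbit, `∑ wⁿ Tⁿx` is then controlled by `‖x‖` on `|w| = 1/ρ`, and Cauchy's
estimate gives `‖Tⁿx‖ ≤ const · ρⁿ‖x‖`. This contradicts growth like `rⁿ` once `n` is large.

Such a circle exists because a nonzero shift `S - μ` is bounded below as soon as it is injective
(`IsStrictlySingular.isBoundedBelowOn`) and `S` has only countably many eigenvalues
(`IsStrictlySingular.countable_pointSpectrum`). Only point spectrum and lower bounds are needed;
surjectivity of `z - T` plays no role. -/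

/-- `A` is bounded below on the subspace `W`. -/
def IsBoundedBelowOn (A : X →L[ℂ] X) (W : Submodule ℂ X) : Prop :=
  ∃ c : ℝ, 0 < c ∧ ∀ w ∈ W, c * ‖w‖ ≤ ‖A w‖

theorem IsBoundedBelowOn.antilipschitz {A : X →L[ℂ] X} {W : Submodule ℂ X}
    (h : IsBoundedBelowOn A W) :
    ∃ K, AntilipschitzWith K (A.comp W.subtypeL) := by
  obtain ⟨c, hc, h⟩ := h
  refine ⟨(⟨c, hc.le⟩ : NNReal)⁻¹, ContinuousLinearMap.antilipschitz_of_bound _ fun x => ?_⟩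
  have := h x x.2
  change ‖(x : X)‖ ≤ c⁻¹ * ‖A x‖
  rw [inv_mul_eq_div, le_div_iff₀ hc]
  linarith

theorem IsBoundedBelowOn.isClosed_map [CompleteSpace X] {A : X →L[ℂ] X} {W : Submodule ℂ X}
    (hW : IsClosed (W : Set X)) (h : IsBoundedBelowOn A W) :
    IsClosed (W.map (A : X →ₗ[ℂ] X) : Set X) := by
  obtain ⟨K, hK⟩ := h.antilipschitz
  have : CompleteSpace W := hW.completeSpace_coe
  have h2 := hK.isClosed_range (A.comp W.subtypeL).uniformContinuous
  convert h2 using 1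
  ext y
  simp

theorem IsStrictlySingular.finiteDimensional {S : X →L[ℂ] X} (hS : IsStrictlySingular S)
    {M : Submodule ℂ X} (h : IsBoundedBelowOn S M) : FiniteDimensional ℂ M := by
  by_contra hM
  obtain ⟨K, hK⟩ := h.antilipschitz
  exact hS M hM (hK.isUniformEmbedding (S.comp M.subtypeL).uniformContinuous).isEmbedding

/-- Boundedness below of an injective operator passes from a hyperplane to the whole space. -/
theorem IsBoundedBelowOn.of_inf_ker [CompleteSpace X] {A : X →L[ℂ] X} {W : Submodule ℂ X}
    (hW : IsClosed (W : Set X)) (hinj : ∀ w ∈ W, A w = 0 → w = 0) (φ : X →L[ℂ] ℂ)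
    (h : IsBoundedBelowOn A (W ⊓ LinearMap.ker (φ : X →ₗ[ℂ] ℂ))) : IsBoundedBelowOn A W := by
  by_cases hφ : ∀ w ∈ W, φ w = 0
  · obtain ⟨c, hc, h⟩ := h
    exact ⟨c, hc, fun w hw => h w ⟨hw, by simpa using hφ w hw⟩⟩
  push Not at hφ
  obtain ⟨v, hv, hφv⟩ := hφ
  obtain ⟨u, hu, hφu⟩ : ∃ u ∈ W, φ u = 1 :=
    ⟨(φ v)⁻¹ • v, W.smul_mem _ hv, by simp [hφv]⟩
  set K := W ⊓ LinearMap.ker (φ : X →ₗ[ℂ] ℂ) with hKdef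
  have hK : IsClosed (K : Set X) := by
    rw [hKdef, Submodule.coe_inf]
    exact hW.inter φ.isClosed_ker
  have hcl := h.isClosed_map hK
  have hnot : A u ∉ (K.map (A : X →ₗ[ℂ] X) : Set X) := by
    rintro ⟨k, hk, hku⟩
    have h0 : u - k = 0 := hinj _ (W.sub_mem hu hk.1) (by
      have : A k = A u := hku
      simp [this])
    have h1 : φ k = 0 := hk.2
    have : φ (u - k) = 1 := by simp [hφu, h1]
    rw [h0] at this
    simp at this
  -- `A u` has positive distance `d` from the closed subspace `A K`, so `‖A w‖` controls the
  -- `u`-coordinate `φ w`, and then the `K`-component of `w`.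
  obtain ⟨d, hd, hball⟩ := Metric.isOpen_iff.1 hcl.isOpen_compl _ hnot
  have hdist : ∀ k ∈ K, d ≤ ‖A u + A k‖ := by
    intro k hk
    by_contra hlt
    push Not at hlt
    have : A (-k) ∈ Metric.ball (A u) d := by
      rw [mem_ball_iff_norm, ← norm_neg, map_neg, neg_sub, sub_neg_eq_add]
      exact hlt
    exact hball this ⟨-k, K.neg_mem hk, rfl⟩
  have hscaled : ∀ (a : ℂ), ∀ k ∈ K, ‖a‖ * d ≤ ‖A (k + a • u)‖ := by
    intro a k hk
    by_cases ha : a = 0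
    · simp [ha]
    have := hdist (a⁻¹ • k) (K.smul_mem _ hk)
    have e : A (k + a • u) = a • (A u + A (a⁻¹ • k)) := by
      rw [smul_add, map_smul A a⁻¹ k, smul_inv_smul₀ ha]
      simp [add_comm]
    rw [e, norm_smul]
    gcongr
  obtain ⟨c, hc, h⟩ := h
  refine ⟨((1 + ‖A u‖ / d) / c + ‖u‖ / d)⁻¹, by positivity, fun w hw => ?_⟩
  have hk : w - φ w • u ∈ K :=
    ⟨W.sub_mem hw (W.smul_mem _ hu), by simp [hφu]⟩
  have h1 := hscaled (φ w) _ hk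
  rw [sub_add_cancel] at h1
  have h2 := h _ hk
  have ha : ‖φ w‖ ≤ ‖A w‖ / d := by rwa [le_div_iff₀ hd]
  have h3 : ‖A (w - φ w • u)‖ ≤ ‖A w‖ + ‖A w‖ / d * ‖A u‖ := by
    rw [map_sub, map_smul]
    refine (norm_sub_le _ _).trans ?_
    rw [norm_smul]
    gcongr
  have h4 : ‖w - φ w • u‖ ≤ (‖A w‖ + ‖A w‖ / d * ‖A u‖) / c := by
    rw [le_div_iff₀ hc]
    linarith
  have h5 : ‖w‖ ≤ ‖w - φ w • u‖ + ‖A w‖ / d * ‖u‖ := by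
    calc ‖w‖ = ‖(w - φ w • u) + φ w • u‖ := by rw [sub_add_cancel]
      _ ≤ _ := (norm_add_le _ _).trans (by rw [norm_smul]; gcongr)
  rw [inv_mul_eq_div, div_le_iff₀ (by positivity)]
  calc ‖w‖ ≤ _ := h5
    _ ≤ (‖A w‖ + ‖A w‖ / d * ‖A u‖) / c + ‖A w‖ / d * ‖u‖ := by gcongr
    _ = _ := by field_simp

theorem exists_unit_dual_of_not_isBoundedBelowOn {A : X →L[ℂ] X} {W : Submodule ℂ X}
    (h : ¬ IsBoundedBelowOn A W) {δ : ℝ} (hδ : 0 < δ) :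
    ∃ (w : X) (φ : X →L[ℂ] ℂ), w ∈ W ∧ ‖w‖ = 1 ∧ ‖A w‖ ≤ δ ∧ ‖φ‖ = 1 ∧ φ w = 1 := by
  have : ∃ w ∈ W, ‖A w‖ < δ * ‖w‖ := by
    by_contra hcon
    push Not at hcon
    exact h ⟨δ, hδ, hcon⟩
  obtain ⟨v, hv, hlt⟩ := this
  have hv0 : ‖v‖ ≠ 0 := by
    intro h0
    rw [h0, mul_zero] at hlt
    exact absurd hlt (norm_nonneg _).not_gt
  have hpos : 0 < ‖v‖ := lt_of_le_of_ne (norm_nonneg _) (Ne.symm hv0)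
  obtain ⟨φ, hφ, hφv⟩ := exists_dual_vector ℂ v hv0
  refine ⟨((‖v‖ : ℂ)⁻¹) • v, φ, W.smul_mem _ hv, ?_, ?_, hφ, ?_⟩
  · simp [norm_smul, hv0]
  · rw [map_smul, norm_smul, norm_inv, Complex.norm_real, norm_norm, inv_mul_eq_div,
      div_le_iff₀ hpos]
    exact hlt.le
  · rw [map_smul, hφv]
    simp [norm_ne_zero_iff.1 hv0]

/-- A triangular dual system has coefficients growing at most like `2 ^ i`. -/
theorem norm_coeff_le_of_triangular {w : ℕ → X} {φ : ℕ → X →L[ℂ] ℂ} (hw : ∀ n, ‖w n‖ = 1)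
    (hφ : ∀ n, ‖φ n‖ = 1) (hφw : ∀ n, φ n (w n) = 1) (hlt : ∀ i j, i < j → φ i (w j) = 0)
    (a : ℕ →₀ ℂ) (i : ℕ) : ‖a i‖ ≤ 2 ^ i * ‖Finsupp.linearCombination ℂ w a‖ := by
  set x := Finsupp.linearCombination ℂ w a with hx
  obtain ⟨n, hn⟩ := a.support.exists_nat_subset_range
  induction i using Nat.strong_induction_on with
  | _ i ih =>
    have hsup : a.support ⊆ Finset.range (max n (i + 1)) :=
      hn.trans (Finset.range_subset_range.2 (le_max_left _ _))
    have hxe : x = ∑ j ∈ Finset.range (max n (i + 1)), a j • w j := by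
      rw [hx, Finsupp.linearCombination_apply]
      exact Finsupp.sum_of_support_subset _ hsup _ (by simp)
    have hφx : φ i x = ∑ j ∈ Finset.range i, a j * φ i (w j) + a i := by
      rw [hxe, map_sum, ← Finset.sum_subset
        (Finset.range_subset_range.2 (le_max_right n (i + 1))), Finset.sum_range_succ]
      · simp [hφw]
      · intro j _ hj
        have : i < j := by
          rw [Finset.mem_range] at hj
          omega
        simp [hlt i j this]
    have hb : ‖φ i x‖ ≤ ‖x‖ := by simpa [hφ] using (φ i).le_opNorm x
    have hs : ‖∑ j ∈ Finset.range i, a j * φ i (w j)‖ ≤ (2 ^ i - 1) * ‖x‖ := by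
      calc _ ≤ ∑ j ∈ Finset.range i, 2 ^ j * ‖x‖ := by
            refine norm_sum_le_of_le _ fun j hj => ?_
            have h1 := ih j (Finset.mem_range.1 hj)
            have h2 : ‖φ i (w j)‖ ≤ 1 := by simpa [hφ, hw] using (φ i).le_opNorm (w j)
            rw [norm_mul]
            exact (mul_le_of_le_one_right (norm_nonneg _) h2).trans h1
        _ = _ := by
            rw [← Finset.sum_mul, geom_sum_eq (by norm_num)]
            norm_num
    have e : a i = φ i x - ∑ j ∈ Finset.range i, a j * φ i (w j) := by rw [hφx]; ring
    calc ‖a i‖ ≤ ‖φ i x‖ + ‖∑ j ∈ Finset.range i, a j * φ i (w j)‖ := by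
          rw [e]; exact norm_sub_le _ _
      _ ≤ ‖x‖ + (2 ^ i - 1) * ‖x‖ := add_le_add hb hs
      _ = _ := by ring

/-- Choose an almost-null unit vector and a norming functional, pass to the kernel of that
functional, and repeat. By `IsBoundedBelowOn.of_inf_ker` the failure of boundedness below survives
each cut. -/
theorem exists_triangular_of_not_isBoundedBelowOn [CompleteSpace X] {A : X →L[ℂ] X}
    {W : Submodule ℂ X} (hW : IsClosed (W : Set X)) (hinj : ∀ w ∈ W, A w = 0 → w = 0)
    (h : ¬ IsBoundedBelowOn A W) {δ : ℕ → ℝ} (hδ : ∀ n, 0 < δ n) :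
    ∃ (w : ℕ → X) (φ : ℕ → X →L[ℂ] ℂ), (∀ n, ‖w n‖ = 1) ∧ (∀ n, ‖A (w n)‖ ≤ δ n) ∧
      (∀ n, ‖φ n‖ = 1) ∧ (∀ n, φ n (w n) = 1) ∧ ∀ i j, i < j → φ i (w j) = 0 := by
  let G := {U : Submodule ℂ X // IsClosed (U : Set X) ∧ (∀ w ∈ U, A w = 0 → w = 0) ∧
    ¬ IsBoundedBelowOn A U}
  have hex : ∀ (U : G) (n : ℕ), ∃ (w : X) (φ : X →L[ℂ] ℂ),
      w ∈ U.1 ∧ ‖w‖ = 1 ∧ ‖A w‖ ≤ δ n ∧ ‖φ‖ = 1 ∧ φ w = 1 := fun U n =>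
    exists_unit_dual_of_not_isBoundedBelowOn U.2.2.2 (hδ n)
  choose w φ hwW hw hAw hφ hφw using hex
  let next : G → ℕ → G := fun U n =>
    ⟨U.1 ⊓ LinearMap.ker (φ U n : X →ₗ[ℂ] ℂ), by
      rw [Submodule.coe_inf]; exact U.2.1.inter (φ U n).isClosed_ker,
      fun w hw => U.2.2.1 w hw.1,
      fun hb => U.2.2.2 (hb.of_inf_ker U.2.1 U.2.2.1)⟩
  let σ : ℕ → G := fun n => Nat.rec ⟨W, hW, hinj, h⟩ (fun n U => next U n) n
  have hσ : ∀ n, σ (n + 1) = next (σ n) n := fun n => rfl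
  have hanti : Antitone fun n => (σ n).1 := antitone_nat_of_succ_le fun n => by
    rw [hσ]; exact inf_le_left
  refine ⟨fun n => w (σ n) n, fun n => φ (σ n) n, fun n => hw _ _, fun n => hAw _ _,
    fun n => hφ _ _, fun n => hφw _ _, fun i j hij => ?_⟩
  have hle : (σ j).1 ≤ (σ (i + 1)).1 := hanti (Nat.succ_le_of_lt hij)
  have : w (σ j) j ∈ (σ (i + 1)).1 := hle (hwW (σ j) j)
  rw [hσ] at this
  exact this.2

/-- A nonzero shift of a strictly singular operator is bounded below wherever it is injective. -/
theorem IsStrictlySingular.isBoundedBelowOn [CompleteSpace X] {S : X →L[ℂ] X}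
    (hS : IsStrictlySingular S) {μ : ℂ} (hμ : μ ≠ 0) {W : Submodule ℂ X}
    (hW : IsClosed (W : Set X))
    (hinj : ∀ w ∈ W, (S - μ • ContinuousLinearMap.id ℂ X) w = 0 → w = 0) :
    IsBoundedBelowOn (S - μ • ContinuousLinearMap.id ℂ X) W := by
  by_contra hnot
  have hμ' : 0 < ‖μ‖ := norm_pos_iff.2 hμ
  set A := S - μ • ContinuousLinearMap.id ℂ X with hA
  obtain ⟨w, φ, hw, hAw, hφ, hφw, hlt⟩ := exists_triangular_of_not_isBoundedBelowOn hW hinj hnot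
    -- The factor `4⁻ⁿ` beats the coefficient growth `2ⁿ`; the remaining geometric series sums to
    -- `2`, so `‖A x‖ ≤ ‖μ‖/2 · ‖x‖` on the span. There `S = A + μ` is bounded below by `‖μ‖/2`,
    -- although the span is infinite dimensional.
    (δ := fun n => ‖μ‖ / 4 * (1 / 4) ^ n) (fun n => by positivity)
  have hcoeff := norm_coeff_le_of_triangular hw hφ hφw hlt
  have hli : LinearIndependent ℂ w := by
    rw [linearIndependent_iff]
    intro a ha
    ext i
    have := hcoeff a i
    rw [ha] at this
    simpa using this
  have hsmall : ∀ a : ℕ →₀ ℂ, ‖A (Finsupp.linearCombination ℂ w a)‖ ≤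
      ‖μ‖ / 2 * ‖Finsupp.linearCombination ℂ w a‖ := by
    intro a
    set x := Finsupp.linearCombination ℂ w a with hx
    have e : A x = ∑ i ∈ a.support, a i • A (w i) := by
      rw [hx, Finsupp.linearCombination_apply, Finsupp.sum, map_sum]
      simp
    calc ‖A x‖ ≤ ∑ i ∈ a.support, (‖μ‖ / 4 * ‖x‖) * (1 / 2) ^ i := by
          rw [e]
          refine norm_sum_le_of_le _ fun i _ => ?_
          rw [norm_smul]
          calc ‖a i‖ * ‖A (w i)‖ ≤ (2 ^ i * ‖x‖) * (‖μ‖ / 4 * (1 / 4) ^ i) :=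
                mul_le_mul (hcoeff a i) (hAw i) (norm_nonneg _) (by positivity)
            _ = (‖μ‖ / 4 * ‖x‖) * (2 * (1 / 4)) ^ i := by rw [mul_pow]; ring
            _ = _ := by norm_num
      _ ≤ (‖μ‖ / 4 * ‖x‖) * 2 := by
          rw [← Finset.mul_sum]
          gcongr
          exact (summable_geometric_two.sum_le_tsum _ fun _ _ => by positivity).trans_eq
            tsum_geometric_two
      _ = _ := by ring
  have hfin : FiniteDimensional ℂ (Submodule.span ℂ (Set.range w)) := by
    refine hS.finiteDimensional ⟨‖μ‖ / 2, by positivity, fun x hx => ?_⟩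
    rw [← Finsupp.range_linearCombination] at hx
    obtain ⟨a, rfl⟩ := hx
    have h1 := hsmall a
    set x := Finsupp.linearCombination ℂ w a
    have e : μ • x = S x - A x := by simp [hA]
    have h2 : ‖μ‖ * ‖x‖ ≤ ‖S x‖ + ‖A x‖ := by
      rw [← norm_smul, e]; exact norm_sub_le _ _
    linarith
  exact Module.Finite.not_linearIndependent_of_infinite _ (linearIndependent_span hli)

end BoundedBelow

/-! ### Countability of the point spectrum. -/

section PointSpectrum

variable {X : Type*} [NormedAddCommGroup X] [NormedSpace ℂ X]

/-- The set of eigenvalues of `S`. -/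
def pointSpectrum (S : X →L[ℂ] X) : Set ℂ :=
  {z | ∃ e : X, e ≠ 0 ∧ S e = z • e}

theorem norm_le_of_mem_pointSpectrum {S : X →L[ℂ] X} {z : ℂ} (hz : z ∈ pointSpectrum S) :
    ‖z‖ ≤ ‖S‖ := by
  obtain ⟨e, he, hSe⟩ := hz
  have h := S.le_opNorm e
  rw [hSe, norm_smul] at h
  exact le_of_mul_le_mul_right h (norm_pos_iff.2 he)

/-- A nonzero shift of a strictly singular operator maps closed subspaces onto closed subspaces,
with controlled preimages. -/
theorem IsStrictlySingular.isClosed_map [CompleteSpace X] {S : X →L[ℂ] X}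
    (hS : IsStrictlySingular S) {μ : ℂ} (hμ : μ ≠ 0) {V : Submodule ℂ X}
    (hV : IsClosed (V : Set X)) :
    IsClosed (V.map ((S - μ • ContinuousLinearMap.id ℂ X : X →L[ℂ] X) : X →ₗ[ℂ] X) : Set X) ∧
    ∃ C : ℝ, 0 < C ∧ ∀ v ∈ V, ∃ w ∈ V, (S - μ • ContinuousLinearMap.id ℂ X) w =
      (S - μ • ContinuousLinearMap.id ℂ X) v ∧
      ‖w‖ ≤ C * ‖(S - μ • ContinuousLinearMap.id ℂ X) v‖ := by
  set A := S - μ • ContinuousLinearMap.id ℂ X with hA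
  set N := V ⊓ LinearMap.ker (A : X →ₗ[ℂ] X) with hN
  have hNfin : FiniteDimensional ℂ N := by
    refine hS.finiteDimensional ⟨‖μ‖, norm_pos_iff.2 hμ, fun w hw => ?_⟩
    have h0 : A w = 0 := hw.2
    have : S w = μ • w := by
      rw [hA] at h0
      simpa [sub_eq_zero] using h0
    rw [this, norm_smul]
  -- The finite-dimensional kernel `N` is split off by a closed complement, on which `A` is
  -- injective and hence bounded below.
  obtain ⟨Q, hQ, hNQ⟩ :=
    (Submodule.ClosedComplemented.of_finiteDimensional N).exists_isClosed_isCompl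
  have hW : IsClosed ((V ⊓ Q : Submodule ℂ X) : Set X) := by
    rw [Submodule.coe_inf]; exact hV.inter hQ
  have hb : IsBoundedBelowOn A (V ⊓ Q) := by
    refine hS.isBoundedBelowOn hμ hW fun w hw h0 => ?_
    have : w ∈ N ⊓ Q := ⟨⟨hw.1, h0⟩, hw.2⟩
    rw [hNQ.inf_eq_bot] at this
    simpa using this
  have hdec : ∀ v ∈ V, ∃ w ∈ V ⊓ Q, A w = A v := by
    intro v hv
    have : v ∈ N ⊔ Q := by rw [hNQ.sup_eq_top]; trivial
    obtain ⟨n, hn, q, hq, rfl⟩ := Submodule.mem_sup.1 this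
    refine ⟨q, ⟨?_, hq⟩, ?_⟩
    · simpa using V.sub_mem hv hn.1
    · have : A n = 0 := hn.2
      simp [this]
  constructor
  · have h := hb.isClosed_map hW
    convert h using 1
    ext y
    constructor
    · rintro ⟨v, hv, rfl⟩
      obtain ⟨w, hw, hwv⟩ := hdec v hv
      exact ⟨w, hw, hwv⟩
    · rintro ⟨w, hw, rfl⟩
      exact ⟨w, hw.1, rfl⟩
  · obtain ⟨c, hc, hb⟩ := hb
    refine ⟨c⁻¹, inv_pos.2 hc, fun v hv => ?_⟩
    obtain ⟨w, hw, hwv⟩ := hdec v hv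
    refine ⟨w, hw.1, hwv, ?_⟩
    rw [← hwv, inv_mul_eq_div, le_div_iff₀ hc]
    linarith [hb w hw]

/-- If `A` is onto `V` with bounded right inverse and `A` has a kernel vector in `V`, then all
small scalars are eigenvalues of `A`. -/
theorem exists_eigenvector_of_surjective [CompleteSpace X] {A : X →L[ℂ] X} {V : Set X} {C : ℝ}
    (hsurj : ∀ v ∈ V, ∃ w ∈ V, A w = v ∧ ‖w‖ ≤ C * ‖v‖) {k : X} (hk : k ∈ V)
    (hk0 : k ≠ 0) (hAk : A k = 0) {ε : ℂ} (hε : ‖ε‖ * C ≤ 1 / 3) :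
    ∃ y : X, y ≠ 0 ∧ A y = ε • y := by
  choose g hgV hgA hgC using fun v : V => hsurj v v.2
  -- Iterated preimages `A xₙ₊₁ = xₙ` with `x₀ = k`; the eigenvector is `∑ εⁿ xₙ`. It is nonzero
  -- because the ratio `1/3` keeps the tail after `k` below `‖k‖/2`.
  let x : ℕ → V := fun n => (fun v => ⟨g v, hgV v⟩)^[n] ⟨k, hk⟩
  have hx0 : (x 0 : X) = k := rfl
  have hxs : ∀ n, (x (n + 1) : X) = g (x n) := fun n => by
    simp only [x, Function.iterate_succ_apply']
  have hxA : ∀ n, A (x (n + 1)) = x n := fun n => by rw [hxs, hgA]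
  have hxC : ∀ n, ‖(x (n + 1) : X)‖ ≤ C * ‖(x n : X)‖ := fun n => by rw [hxs]; exact hgC (x n)
  have hbound : ∀ n, ‖ε ^ n • (x n : X)‖ ≤ ‖k‖ * (1 / 3) ^ n := by
    intro n
    induction n with
    | zero => simp [hx0]
    | succ n ih =>
      rw [norm_smul, norm_pow] at ih ⊢
      calc ‖ε‖ ^ (n + 1) * ‖(x (n + 1) : X)‖ ≤ ‖ε‖ ^ (n + 1) * (C * ‖(x n : X)‖) := by
            gcongr; exact hxC n
        _ = (‖ε‖ * C) * (‖ε‖ ^ n * ‖(x n : X)‖) := by ring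
        _ ≤ (1 / 3) * (‖k‖ * (1 / 3) ^ n) := by gcongr
        _ = _ := by ring
  have hgeo : Summable fun n : ℕ => ‖k‖ * (1 / 3 : ℝ) ^ n :=
    (summable_geometric_of_lt_one (by norm_num) (by norm_num)).mul_left _
  have hsum : Summable fun n => ε ^ n • (x n : X) := .of_norm_bounded hgeo hbound
  have hsplit := hsum.tsum_eq_zero_add
  refine ⟨∑' n, ε ^ n • (x n : X), fun h0 => ?_, ?_⟩
  · rw [h0] at hsplit
    have htail : ‖∑' n, ε ^ (n + 1) • (x (n + 1) : X)‖ ≤ ‖k‖ / 2 := by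
      refine tsum_of_norm_bounded (g := fun n : ℕ => ‖k‖ / 3 * (1 / 3 : ℝ) ^ n) ?_ fun n => ?_
      · have hgeom := (hasSum_geometric_of_lt_one (r := (1 / 3 : ℝ)) (by norm_num)
          (by norm_num)).mul_left (‖k‖ / 3)
        rwa [show ‖k‖ / 3 * (1 - 1 / 3 : ℝ)⁻¹ = ‖k‖ / 2 by ring] at hgeom
      · exact (hbound (n + 1)).trans_eq (by ring)
    have hk' : k = -∑' n, ε ^ (n + 1) • (x (n + 1) : X) := by
      rw [eq_neg_iff_add_eq_zero]
      simpa [hx0] using hsplit.symm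
    have hkn : ‖k‖ ≤ ‖k‖ / 2 := by
      calc ‖k‖ = _ := by rw [hk', norm_neg]
        _ ≤ _ := htail
    have := norm_pos_iff.2 hk0
    linarith
  · rw [A.map_tsum hsum, (A.summable hsum).tsum_eq_zero_add, ← tsum_const_smul'' ε]
    simp [hx0, hAk, hxA, pow_succ', mul_smul]

/-- Nonzero accumulation points of the point spectrum of a strictly singular operator are interior
to the point spectrum. -/
theorem IsStrictlySingular.pointSpectrum_mem_nhds [CompleteSpace X] {S : X →L[ℂ] X}
    (hS : IsStrictlySingular S) {μ : ℂ} (hμ : μ ≠ 0) (hacc : AccPt μ (𝓟 (pointSpectrum S))) :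
    pointSpectrum S ∈ 𝓝 μ := by
  set A := S - μ • ContinuousLinearMap.id ℂ X with hA
  have hAe : ∀ {e : X} {ν : ℂ}, S e = ν • e → A e = (ν - μ) • e := by
    intro e ν h
    simp [hA, h, sub_smul]
  -- `A` rescales each of these eigenvectors by `ν - μ ≠ 0`, so its closed image of `V` contains
  -- `U`, hence `V`.
  set U := Submodule.span ℂ {e : X | ∃ ν : ℂ, ν ≠ μ ∧ S e = ν • e} with hU
  set V := U.topologicalClosure with hVdef
  have hV : IsClosed (V : Set X) := U.isClosed_topologicalClosure
  obtain ⟨hcl, C, hC, hpre⟩ := hS.isClosed_map hμ hV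
  have hUV : U ≤ V := U.le_topologicalClosure
  have hle : V ≤ V.map (A : X →ₗ[ℂ] X) := by
    refine U.topologicalClosure_minimal (Submodule.span_le.2 ?_) hcl
    rintro e ⟨ν, hν, he⟩
    have hν' : ν - μ ≠ 0 := sub_ne_zero.2 hν
    refine ⟨(ν - μ)⁻¹ • e, V.smul_mem _ (hUV (Submodule.subset_span ⟨ν, hν, he⟩)), ?_⟩
    change A ((ν - μ)⁻¹ • e) = e
    rw [map_smul, hAe he, inv_smul_smul₀ hν']
  have hsurj : ∀ v ∈ (V : Set X), ∃ w ∈ (V : Set X), A w = v ∧ ‖w‖ ≤ C * ‖v‖ := by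
    intro v hv
    obtain ⟨u, hu, rfl⟩ := hle hv
    exact hpre u hu
  -- Without a kernel vector, `A` would have a lower bound `c` on `V`, but some eigenvalue `ν ≠ μ`
  -- lies within `c` of `μ`.
  obtain ⟨k, hk, hk0, hAk⟩ : ∃ k ∈ V, k ≠ 0 ∧ A k = 0 := by
    by_contra hcon
    push Not at hcon
    obtain ⟨c, hc, hb⟩ := hS.isBoundedBelowOn hμ hV fun w hw h0 => by
      by_contra hw0
      exact hcon w hw hw0 h0
    obtain ⟨ν, ⟨hνball, hνE⟩, hνμ⟩ := accPt_iff_nhds.1 hacc _ (Metric.ball_mem_nhds μ hc)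
    obtain ⟨e, he0, he⟩ := hνE
    have h := hb e (hUV (Submodule.subset_span ⟨ν, hνμ, he⟩))
    rw [← hA, hAe he, norm_smul] at h
    have h' := le_of_mul_le_mul_right h (norm_pos_iff.2 he0)
    rw [mem_ball_iff_norm] at hνball
    linarith
  refine Filter.mem_of_superset (Metric.ball_mem_nhds μ (ε := 1 / (3 * C)) (by positivity)) ?_
  intro z hz
  have hz' : ‖z - μ‖ * C ≤ 1 / 3 := by
    rw [mem_ball_iff_norm] at hz
    calc _ ≤ 1 / (3 * C) * C := by gcongr
      _ = _ := by field_simp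
  obtain ⟨y, hy0, hy⟩ := exists_eigenvector_of_surjective hsurj hk hk0 hAk hz'
  refine ⟨y, hy0, ?_⟩
  have : S y = A y + μ • y := by simp [hA]
  rw [this, hy, ← add_smul, sub_add_cancel]

/-- The accumulation points form a compact set. One of maximal modulus would be nonzero, hence
interior to the point spectrum, so points slightly farther out would accumulate too. -/
theorem IsStrictlySingular.not_accPt_pointSpectrum [CompleteSpace X] {S : X →L[ℂ] X}
    (hS : IsStrictlySingular S) {μ : ℂ} (hμ : μ ≠ 0) : ¬ AccPt μ (𝓟 (pointSpectrum S)) := by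
  intro hacc
  have hsub : derivedSet (pointSpectrum S) ⊆ Metric.closedBall 0 ‖S‖ := by
    refine (derivedSet_subset_closure _).trans (closure_minimal (fun z hz => ?_)
      Metric.isClosed_closedBall)
    simpa using norm_le_of_mem_pointSpectrum hz
  have hcomp : IsCompact (derivedSet (pointSpectrum S)) :=
    (isCompact_closedBall (0 : ℂ) ‖S‖).of_isClosed_subset (isClosed_derivedSet _) hsub
  obtain ⟨ν, hν, hmax⟩ := hcomp.exists_isMaxOn ⟨μ, hacc⟩ continuous_norm.continuousOn
  have hν0 : 0 < ‖ν‖ := (norm_pos_iff.2 hμ).trans_le (hmax hacc)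
  obtain ⟨δ, hδ, hball⟩ := Metric.mem_nhds_iff.1
    (hS.pointSpectrum_mem_nhds (norm_pos_iff.1 hν0) hν)
  obtain ⟨t, ht0, ht⟩ := exists_between (show (0 : ℝ) < δ / ‖ν‖ by positivity)
  rw [lt_div_iff₀ hν0] at ht
  set z : ℂ := ((1 + t : ℝ) : ℂ) * ν with hz
  have hzball : z ∈ Metric.ball ν δ := by
    have : z - ν = (t : ℂ) * ν := by rw [hz]; push_cast; ring
    rw [mem_ball_iff_norm, this, norm_mul, Complex.norm_real, Real.norm_of_nonneg ht0.le]
    exact ht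
  have hznhds : pointSpectrum S ∈ 𝓝 z :=
    mem_of_superset (Metric.isOpen_ball.mem_nhds hzball) hball
  have hzacc : z ∈ derivedSet (pointSpectrum S) := by
    rw [mem_derivedSet, AccPt, inf_eq_left.2]
    · infer_instance
    · exact le_principal_iff.2 (mem_nhdsWithin_of_mem_nhds hznhds)
  have h := hmax hzacc
  change ‖z‖ ≤ ‖ν‖ at h
  rw [hz, norm_mul, Complex.norm_real, Real.norm_of_nonneg (by linarith)] at h
  nlinarith

theorem IsStrictlySingular.countable_pointSpectrum [CompleteSpace X] {S : X →L[ℂ] X}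
    (hS : IsStrictlySingular S) : (pointSpectrum S).Countable := by
  have hd : DiscreteTopology ↥(pointSpectrum S \ {0}) := by
    rw [discreteTopology_subtype_iff]
    intro z hz
    by_contra hne
    refine hS.not_accPt_pointSpectrum hz.2 ?_
    exact AccPt.mono ⟨hne⟩ (principal_mono.2 Set.sdiff_subset)
  have hc : (pointSpectrum S \ {0}).Countable := countable_of_Lindelof_of_discrete
  exact (hc.union (Set.countable_singleton 0)).mono fun z hz => by
    by_cases h : z = 0
    · exact Or.inr h
    · exact Or.inl ⟨hz, h⟩

end PointSpectrum

/-! ### Orbit growth via Cauchy's estimate. -/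

section Orbit

variable {X : Type*} [NormedAddCommGroup X] [NormedSpace ℂ X]

/-- Cauchy's estimate for a vector-valued power series with bounded coefficients. -/
theorem norm_coeff_le_of_norm_tsum_le [CompleteSpace X] {a : ℕ → X} {B : ℝ}
    (hB : ∀ n, ‖a n‖ ≤ B) {R M : ℝ} (hR : 0 < R) (hR1 : R < 1)
    (hM : ∀ w : ℂ, ‖w‖ = R → ‖∑' n, w ^ n • a n‖ ≤ M) (n : ℕ) : ‖a n‖ ≤ M / R ^ n := by
  let p : FormalMultilinearSeries ℂ ℂ X := fun n =>
    ContinuousMultilinearMap.mkPiRing ℂ (Fin n) (a n)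
  have hp : ∀ (w : ℂ) n, (p n fun _ => w) = w ^ n • a n := fun w n => by simp [p]
  have hrad : ((1 : NNReal) : ENNReal) ≤ p.radius :=
    p.le_radius_of_bound B fun n => by simpa [p] using hB n
  have hps : HasFPowerSeriesOnBall p.sum p 0 1 :=
    (p.hasFPowerSeriesOnBall (lt_of_lt_of_le (by simp) hrad)).mono (by simp) (by simpa using hrad)
  have hdiff : DifferentiableOn ℂ p.sum (Metric.closedBall 0 R) := by
    refine hps.differentiableOn.mono fun w hw => ?_
    have hw' : ‖w‖ < 1 := lt_of_le_of_lt (by simpa using hw) hR1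
    rwa [Metric.mem_eball, edist_zero_right, ← ofReal_norm, ENNReal.ofReal_lt_one]
  have hcont : DiffContOnCl ℂ p.sum (Metric.ball 0 R) := by
    apply DifferentiableOn.diffContOnCl
    rwa [closure_ball _ hR.ne']
  have hle := Complex.norm_iteratedDeriv_le_of_forall_mem_sphere_norm_le (C := M) n hR hcont
    fun z hz => by
      have := hM z (by simpa using hz)
      simpa [FormalMultilinearSeries.sum, hp] using this
  have hcoeff : iteratedDeriv n p.sum 0 = (n.factorial : ℕ) • a n := by
    rw [iteratedDeriv_eq_iteratedFDeriv, ← hps.factorial_smul 1 n, hp]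
    simp
  rw [hcoeff, ← Nat.cast_smul_eq_nsmul ℝ, norm_smul, Real.norm_natCast, mul_div_assoc] at hle
  exact le_of_mul_le_mul_left hle (by positivity)

/-- If `z - T` is uniformly bounded below on a circle of radius `ρ > 1`, then bounded orbits of `T`
grow at most like `ρ ^ n`, with a constant depending linearly on the starting vector. -/
theorem norm_pow_apply_le_of_bounded_orbit [CompleteSpace X] {T : X →L[ℂ] X} {ρ c : ℝ} (hρ : 1 < ρ)
    (hc : 0 < c) (hT : ∀ z : ℂ, ‖z‖ = ρ → ∀ x, c * ‖x‖ ≤ ‖z • x - T x‖) {x : X} {B : ℝ}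
    (hB : ∀ n : ℕ, ‖(T ^ n) x‖ ≤ B) (n : ℕ) : ‖(T ^ n) x‖ ≤ ρ / c * ‖x‖ * ρ ^ n := by
  have hρ0 : 0 < ρ := by linarith
  have h := norm_coeff_le_of_norm_tsum_le (a := fun n => (T ^ n) x) hB (R := ρ⁻¹)
    (M := ρ / c * ‖x‖) (inv_pos.2 hρ0) (inv_lt_one_of_one_lt₀ hρ) (fun w hw => ?_) n
  · simpa [div_eq_mul_inv] using h
  have hw0 : w ≠ 0 := by
    rintro rfl
    rw [norm_zero] at hw
    exact (inv_pos.2 hρ0).ne hw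
  have hsum : Summable fun n : ℕ => w ^ n • (T ^ n) x := by
    refine .of_norm_bounded (g := fun n => B * ρ⁻¹ ^ n)
      ((summable_geometric_of_lt_one (inv_pos.2 hρ0).le
        (inv_lt_one_of_one_lt₀ hρ)).mul_left B) fun n => ?_
    rw [norm_smul, norm_pow, hw, mul_comm]
    gcongr
    exact hB n
  -- This plays the role of `w⁻¹(w⁻¹ - T)⁻¹x`, without assuming that the inverse exists.
  set g := ∑' n : ℕ, w ^ n • (T ^ n) x with hg
  have hTg : g = x + w • T g := by
    rw [hg, T.map_tsum hsum, ← tsum_const_smul'' w, hsum.tsum_eq_zero_add]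
    simp [pow_succ', mul_smul]
  have hres : w⁻¹ • g - T g = w⁻¹ • x := by
    nth_rewrite 1 [hTg]
    rw [smul_add, inv_smul_smul₀ hw0, add_sub_cancel_right]
  have h1 := hT w⁻¹ (by rw [norm_inv, hw, inv_inv]) g
  rw [hres, norm_smul, norm_inv, hw, inv_inv] at h1
  rw [div_mul_eq_mul_div, le_div_iff₀ hc]
  linarith

/-- Pointwise boundedness below of `z - T` is uniform on compact sets. -/
theorem exists_uniform_lower_bound {T : X →L[ℂ] X} {s : Set ℂ} (hs : IsCompact s)
    (h : ∀ z ∈ s, ∃ c : ℝ, 0 < c ∧ ∀ x, c * ‖x‖ ≤ ‖z • x - T x‖) :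
    ∃ c : ℝ, 0 < c ∧ ∀ z ∈ s, ∀ x, c * ‖x‖ ≤ ‖z • x - T x‖ := by
  refine hs.induction_on (p := fun s => ∃ c : ℝ, 0 < c ∧ ∀ z ∈ s, ∀ x, c * ‖x‖ ≤ ‖z • x - T x‖)
    ⟨1, one_pos, by simp⟩ ?_ ?_ ?_
  · rintro s t hst ⟨c, hc, h⟩
    exact ⟨c, hc, fun z hz => h z (hst hz)⟩
  · rintro s t ⟨c, hc, h⟩ ⟨d, hd, h'⟩
    refine ⟨min c d, lt_min hc hd, fun z hz x => ?_⟩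
    rcases hz with hz | hz
    · exact (mul_le_mul_of_nonneg_right (min_le_left _ _) (norm_nonneg _)).trans (h z hz x)
    · exact (mul_le_mul_of_nonneg_right (min_le_right _ _) (norm_nonneg _)).trans (h' z hz x)
  · intro z hz
    obtain ⟨c, hc, h⟩ := h z hz
    refine ⟨_, mem_nhdsWithin_of_mem_nhds (Metric.ball_mem_nhds z (half_pos hc)), c / 2,
      half_pos hc, fun y hy x => ?_⟩
    rw [mem_ball_iff_norm'] at hy
    have h1 := h x
    have e : z • x - T x = (y • x - T x) + (z - y) • x := by rw [sub_smul]; abel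
    have h2 : ‖z • x - T x‖ ≤ ‖y • x - T x‖ + ‖z - y‖ * ‖x‖ := by
      rw [e, ← norm_smul]; exact norm_add_le _ _
    have h3 : ‖z - y‖ * ‖x‖ ≤ c / 2 * ‖x‖ := by gcongr
    linarith

/-- A bounded operator with a circle of radius strictly between `1` and `r` on which `z - T` is
bounded below does not have SDCC-constant `r`. -/
theorem not_isSDCCConstant_of_circle [CompleteSpace X] {T : X →L[ℂ] X} {r ρ : ℝ} (hρ : 1 < ρ)
    (hρr : ρ < r) (hT : ∀ z : ℂ, ‖z‖ = ρ → ∃ c : ℝ, 0 < c ∧ ∀ x, c * ‖x‖ ≤ ‖z • x - T x‖) :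
    ¬ IsSDCCConstant T r := by
  rintro ⟨-, hx⟩
  obtain ⟨c, hc, hT⟩ := exists_uniform_lower_bound (isCompact_sphere (0 : ℂ) ρ)
    fun z hz => hT z (by simpa using hz)
  have hρ0 : 0 < ρ := by linarith
  obtain ⟨m, hm⟩ := pow_unbounded_of_one_lt (ρ / c) ((one_lt_div hρ0).2 hρr)
  obtain ⟨x, hx0, hlim, hgrow⟩ := hx (m + 1)
  obtain ⟨B, hB⟩ := hlim.bddAbove_range
  have h1 := norm_pow_apply_le_of_bounded_orbit hρ hc (fun z hz => hT z (by simpa using hz))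
    (fun n => hB ⟨n, rfl⟩) (m + 1)
  have h2 := (hgrow (m + 1) (by simp) le_rfl).trans h1
  have h3 : r ^ (m + 1) ≤ ρ / c * ρ ^ (m + 1) := by
    refine le_of_mul_le_mul_right ?_ (norm_pos_iff.2 hx0)
    linarith
  rw [← div_le_iff₀ (by positivity), ← div_pow] at h3
  have h4 : (r / ρ) ^ m ≤ (r / ρ) ^ (m + 1) :=
    pow_le_pow_right₀ ((one_lt_div hρ0).2 hρr).le (Nat.le_succ m)
  linarith

end Orbit

theorem corollary3p6 {X : Type*} [NormedAddCommGroup X] [NormedSpace ℂ X] [CompleteSpace X]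
    (S : X →L[ℂ] X) (hS : IsStrictlySingular S) (lam : ℂ) :
    ¬ SatisfiesSDCC (lam • ContinuousLinearMap.id ℂ X + S) := by
  rintro ⟨r, hr⟩
  -- Countably many radii are forbidden. `0` is added since the lower bound needs a nonzero shift `z
  -- - lam`.
  have hcount : ((fun z => ‖lam + z‖) '' (pointSpectrum S ∪ {0})).Countable :=
    (hS.countable_pointSpectrum.union (Set.countable_singleton 0)).image _
  obtain ⟨ρ, hρ, hρr⟩ := (hcount.dense_compl ℝ).exists_mem_open isOpen_Ioo
    (Set.nonempty_Ioo.2 hr.1)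
  refine not_isSDCCConstant_of_circle hρr.1 hρr.2 (fun z hz => ?_) hr
  have hnot : z - lam ∉ pointSpectrum S ∪ {0} := fun h => hρ ⟨z - lam, h, by simpa using hz⟩
  have h0 : z - lam ≠ 0 := fun h => hnot (Or.inr h)
  obtain ⟨c, hc, hb⟩ := hS.isBoundedBelowOn h0 (W := ⊤) isClosed_univ fun w _ hw => by
    by_contra hw0
    exact hnot (Or.inl ⟨w, hw0, by simpa [sub_eq_zero] using hw⟩)
  refine ⟨c, hc, fun x => (hb x trivial).trans_eq ?_⟩
  rw [← norm_neg]
  congr 1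
  simp [sub_smul, sub_sub]
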